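/- Let $(W,S)$ be a finite Coxeter system with length function $\ell$. For $I\subset S$ put $X_I=\{w\in W : \ell(ws)>\ell(w)\ \text{for all } s\in I\}$ and $x_I=\sum_{w\in X_I} w\in\mathbb Q W$. Let $\Sigma(W)\subset\mathbb Q W$ be the $\mathbb Q$-linear span of the elements $x_I$ ($I\subset S$), and let $\Sigma^+(W)\subset\Sigma(W)$ be the set of linear combinations of the $x_I$ with non-negative rational coefficients. Then $\Sigma(W)$ is a unital $\mathbb Q$-subalgebra of $\mathbb Q W$ (Solomon's descent algebra), the minimal polynomial over $\mathbb Q$ of every element of $\Sigma(W)$ splits over $\mathbb Q$, and for every $a\in\Sigma^+(W)$: 1. the minimal polynomial of $a$ over $\mathbb Q$ is square-free; 2. for every integer $n\geq 1$, $a^n\Sigma(W)=a\Sigma(W)$ and $\Sigma(W)a^n=\Sigma(W)a$; 3. for every left $\Sigma(W)$-module $V$, the $\mathbb Q$-linear endomorphism $v\mapsto av$ of $V$ is semisimple. -/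

import Mathlib

namespace SolomonDescent

variable {B W : Type*} [Group W] {M : CoxeterMatrix B}

/-- `X_I`, for a set `I` of simple reflections (indexed by `B`): the set of all `w` in `W` such
that `w s > w` for every `s` in `I`. For a simple reflection `s`, the relation `w s > w` in the
Bruhat order means exactly that the length of `w s` exceeds the length of `w`. -/
def cosetReps (cs : CoxeterSystem M W) (I : Finset B) : Set W :=
  {w | ∀ i ∈ I, cs.length w < cs.length (w * cs.simple i)}

open scoped Classical in
/-- `x_I`, the sum of the elements of `X_I` in the rational group algebra of `W`. -/
noncomputable def xElt [Fintype W] (cs : CoxeterSystem M W) (I : Finset B) : MonoidAlgebra ℚ W :=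
  ∑ w : W with w ∈ cosetReps cs I, MonoidAlgebra.single w (1 : ℚ)

/-- `Σ(W)` as a vector space: the rational span of the elements `x_I`, `I ⊆ S`. -/
noncomputable def descentSpace [Fintype W] (cs : CoxeterSystem M W) :
    Submodule ℚ (MonoidAlgebra ℚ W) :=
  Submodule.span ℚ (Set.range (xElt cs))

/-- `Σ⁺(W)`: the linear combinations of the elements `x_I` with non-negative rational
coefficients. -/
def descentCone [Fintype B] [Fintype W] (cs : CoxeterSystem M W) : Set (MonoidAlgebra ℚ W) :=
  {a | ∃ c : Finset B → ℚ, (∀ I, 0 ≤ c I) ∧ a = ∑ I : Finset B, c I • xElt cs I}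

end SolomonDescent

/-! Solomon's product formula `xElt_mul_xElt` writes `x_I x_J` as the sum of `x_K`, `K = J ∩ d⁻¹Id`,
over the minimal `(W_I, W_J)` double coset representatives `d`. With `x_S = 1` this makes the span a
unital algebra. Since `K ⊆ J`, left multiplication by any element is triangular on the spanning
family, with rational diagonal entries; its minimal polynomial therefore splits.

For `a = ∑ c_I x_I` with `c_I ≥ 0`, the diagonal entry at `J` is `∑ c_I |conjugators I J|`, and
every off-diagonal `K` that occurs has a strictly larger entry (`card_conjugators_lt`,
`eigenvalue_lt`). Hence equal eigenvalues do not interact, one linear factor per distinct eigenvalue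
suffices (`aeval_prod_X_sub_C_eq_zero`), and `a` is killed by a squarefree polynomial. The three
claims are formal consequences.

The Coxeter combinatorics rests on `inversionParity`, a cocycle mod 2 on pairs (element, reflection)
which turns length comparisons into additions. -/

namespace SolomonDescent

open Polynomial

/-! ### The mod 2 inversion cocycle. -/

section InversionCocycle

variable {B W : Type*} [Group W] {M : CoxeterMatrix B} (cs : CoxeterSystem M W)

lemma endMul_apply {α : Type*} (f g : Function.End α) (a : α) : (f * g) a = f (g a) := rfl

open scoped Classical in
/-- The action of a simple reflection on pairs consisting of a group element and a parity. -/
noncomputable def reflectionStep (i : B) : Function.End (W × ZMod 2) :=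
  fun p => (cs.simple i * p.1 * cs.simple i, p.2 + if p.1 = cs.simple i then 1 else 0)

open scoped Classical in
lemma reflectionStep_mul_pow_apply (i j : B) (k : ℕ) (t : W) (e : ZMod 2) :
    ((reflectionStep cs i * reflectionStep cs j) ^ k) (t, e) =
      ((cs.simple i * cs.simple j) ^ k * t * ((cs.simple i * cs.simple j) ^ k)⁻¹,
        e + ∑ l ∈ Finset.range (2 * k),
          if (cs.simple i * cs.simple j) ^ l * t = cs.simple j then 1 else 0) := by
  induction k with
  | zero => simp [Function.End.one_def]
  | succ k ih =>
    -- Dihedral relation: `s_j` inverts `s_i s_j`.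
    have key : ∀ l : ℕ, cs.simple j * ((cs.simple i * cs.simple j) ^ l)⁻¹ =
        (cs.simple i * cs.simple j) ^ l * cs.simple j := by
      intro l
      rw [← inv_pow, mul_inv_rev, cs.inv_simple, cs.inv_simple]
      induction l with
      | zero => simp
      | succ l ih => rw [pow_succ, ← mul_assoc, ih, pow_succ]; simp [mul_assoc]
    rw [pow_succ', endMul_apply, ih, endMul_apply]
    simp only [reflectionStep]
    set c := cs.simple i * cs.simple j with hc
    have hcinv : c⁻¹ = cs.simple j * cs.simple i := by
      rw [hc, mul_inv_rev, cs.inv_simple, cs.inv_simple]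
    have h1 : (c ^ k * t * (c ^ k)⁻¹ = cs.simple j) ↔ c ^ (2 * k) * t = cs.simple j := by
      rw [mul_inv_eq_iff_eq_mul, two_mul, pow_add, mul_assoc]
      have := key k
      constructor
      · intro h; rw [h, ← mul_assoc, ← this]; simp
      · intro h; rw [← mul_right_inj (c ^ k), h, ← mul_assoc, ← this]; simp
    have h2 : (cs.simple j * (c ^ k * t * (c ^ k)⁻¹) * cs.simple j = cs.simple i) ↔
        c ^ (2 * k + 1) * t = cs.simple j := by
      have e1 : (cs.simple j * (c ^ k * t * (c ^ k)⁻¹) * cs.simple j = cs.simple i) ↔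
          c ^ k * t = cs.simple j * cs.simple i * cs.simple j * c ^ k := by
        rw [← mul_inv_eq_iff_eq_mul]
        constructor
        · intro h; rw [← h]; simp [mul_assoc]
        · intro h; rw [h]; simp [mul_assoc]
      rw [e1, ← hcinv]
      have := key k
      have e2 : c ^ (2 * k + 1) = c ^ k * c * c ^ k := by
        rw [← pow_succ, ← pow_add]
        congr 1
        omega
      have e3 : c ^ k * c * (c⁻¹ * cs.simple j * c ^ k) = cs.simple j := by
        rw [show c ^ k * c * (c⁻¹ * cs.simple j * c ^ k) = c ^ k * cs.simple j * c ^ k by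
          simp [mul_assoc], ← this]
        simp
      rw [e2, mul_assoc (c ^ k * c)]
      constructor
      · intro h
        rw [h, e3]
      · intro h
        rw [← mul_right_inj (c ^ k * c), h, e3]
    ext1
    · simp only [hc, pow_succ', mul_inv_rev, cs.inv_simple, mul_assoc]
    · simp only [h1, h2]
      rw [show 2 * (k + 1) = 2 * k + 1 + 1 by ring, Finset.sum_range_succ, Finset.sum_range_succ]
      ring

/-- With `m = M i j`, the `2m` parity contributions have period `m`, so the two halves cancel mod 2.
-/
lemma isLiftable_reflectionStep : M.IsLiftable (reflectionStep cs) := by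
  classical
  intro i j
  funext ⟨t, e⟩
  rw [reflectionStep_mul_pow_apply, cs.simple_mul_simple_pow, two_mul, Finset.sum_range_add]
  simp only [pow_add, cs.simple_mul_simple_pow, one_mul, inv_one, mul_one, Function.End.one_def, id]
  rw [CharTwo.add_self_eq_zero, add_zero]

/-- The parity cocycle of inversions: it is `1` at `(w, t)` if the reflection `t` is a right
inversion of `w`, and `0` otherwise. -/
noncomputable def inversionParity (w t : W) : ZMod 2 :=
  (cs.lift ⟨reflectionStep cs, isLiftable_reflectionStep cs⟩ w (t, 0)).2

open scoped Classical in
lemma lift_reflectionStep_wordProd (ω : List B) (t : W) (e : ZMod 2) :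
    cs.lift ⟨reflectionStep cs, isLiftable_reflectionStep cs⟩ (cs.wordProd ω) (t, e) =
      (cs.wordProd ω * t * (cs.wordProd ω)⁻¹, e + ((cs.rightInvSeq ω).count t : ZMod 2)) := by
  induction ω with
  | nil => simp [Function.End.one_def]
  | cons i ω ih =>
    rw [cs.wordProd_cons, map_mul, cs.lift_apply_simple, endMul_apply,
      ih]
    simp only [reflectionStep, CoxeterSystem.rightInvSeq, List.count_cons]
    ext1
    · simp [mul_assoc]
    · have : (cs.wordProd ω * t * (cs.wordProd ω)⁻¹ = cs.simple i) ↔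
          (cs.wordProd ω)⁻¹ * cs.simple i * cs.wordProd ω = t := by
        constructor
        · intro h; rw [← h]; simp [mul_assoc]
        · intro h; rw [← h]; simp [mul_assoc]
      simp [this, add_assoc]

open scoped Classical in
lemma inversionParity_wordProd (ω : List B) (t : W) :
    inversionParity cs (cs.wordProd ω) t = ((cs.rightInvSeq ω).count t : ZMod 2) := by
  simp [inversionParity, lift_reflectionStep_wordProd]

lemma inversionParity_mul (x y t : W) :
    inversionParity cs (x * y) t = inversionParity cs y t + inversionParity cs x (y * t * y⁻¹) := by
  classical
  obtain ⟨ω, rfl⟩ := cs.wordProd_surjective x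
  obtain ⟨ω', rfl⟩ := cs.wordProd_surjective y
  rw [inversionParity, map_mul, endMul_apply,
    lift_reflectionStep_wordProd, lift_reflectionStep_wordProd, inversionParity_wordProd,
    inversionParity_wordProd, zero_add]

open scoped Classical in
lemma inversionParity_simple (i : B) (t : W) :
    inversionParity cs (cs.simple i) t = if t = cs.simple i then 1 else 0 := by
  rw [inversionParity, cs.lift_apply_simple]
  simp [reflectionStep]

@[simp] lemma inversionParity_one (t : W) : inversionParity cs 1 t = 0 := by
  classical
  simpa using inversionParity_wordProd cs [] t

lemma inversionParity_inv (w t : W) :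
    inversionParity cs w⁻¹ (w * t * w⁻¹) = inversionParity cs w t := by
  have h := inversionParity_mul cs w⁻¹ w t
  rw [inv_mul_cancel, inversionParity_one] at h
  exact ((CharTwo.add_eq_zero).1 h.symm).symm

lemma inversionParity_simple_self (i : B) :
    inversionParity cs (cs.simple i) (cs.simple i) = 1 := by
  classical
  simp [inversionParity_simple]

lemma mem_rightInvSeq_of_inversionParity_ne_zero {ω : List B} {t : W}
    (h : inversionParity cs (cs.wordProd ω) t ≠ 0) : t ∈ cs.rightInvSeq ω := by
  classical
  rw [inversionParity_wordProd] at h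
  by_contra hn
  exact h (by rw [List.count_eq_zero.2 hn, Nat.cast_zero])

lemma length_mul_lt_of_inversionParity_ne_zero {w t : W} (h : inversionParity cs w t ≠ 0) :
    cs.length (w * t) < cs.length w := by
  obtain ⟨ω, hω, rfl⟩ := cs.exists_isReduced w
  exact (cs.isRightInversion_of_mem_rightInvSeq hω
    (mem_rightInvSeq_of_inversionParity_ne_zero cs h)).2

lemma inversionParity_mul_simple_self (w : W) (i : B) :
    inversionParity cs (w * cs.simple i) (cs.simple i) =
      1 + inversionParity cs w (cs.simple i) := by
  simp [inversionParity_mul, inversionParity_simple_self]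

lemma inversionParity_simple_eq_zero_iff (w : W) (i : B) :
    inversionParity cs w (cs.simple i) = 0 ↔ cs.length w < cs.length (w * cs.simple i) := by
  constructor
  · intro h
    have := length_mul_lt_of_inversionParity_ne_zero cs (w := w * cs.simple i) (t := cs.simple i)
      (by rw [inversionParity_mul_simple_self, h]; decide)
    simpa using this
  · intro h
    by_contra hn
    exact absurd (length_mul_lt_of_inversionParity_ne_zero cs hn) (not_lt.2 h.le)

lemma mem_cosetReps_iff {I : Finset B} {w : W} :
    w ∈ cosetReps cs I ↔ ∀ i ∈ I, inversionParity cs w (cs.simple i) = 0 :=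
  forall₂_congr fun i _ => (inversionParity_simple_eq_zero_iff cs w i).symm

end InversionCocycle

/-! ### Parabolic subgroups and minimal coset representatives. -/

section Parabolic

variable {B W : Type*} [Group W] {M : CoxeterMatrix B} (cs : CoxeterSystem M W)

/-- The standard parabolic subgroup generated by the simple reflections in `I`. -/
def parabolic (I : Finset B) : Subgroup W := Subgroup.closure (cs.simple '' I)

variable {cs} {I : Finset B}

lemma simple_mem_parabolic {i : B} (hi : i ∈ I) : cs.simple i ∈ parabolic cs I :=
  Subgroup.subset_closure ⟨i, hi, rfl⟩

lemma mem_parabolic_iff_exists_wordProd {b : W} :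
    b ∈ parabolic cs I ↔ ∃ ω : List B, (∀ i ∈ ω, i ∈ I) ∧ cs.wordProd ω = b := by
  constructor
  · intro hb
    induction hb using Subgroup.closure_induction with
    | mem x hx =>
      obtain ⟨i, hi, rfl⟩ := hx
      exact ⟨[i], by simpa using hi, by simp⟩
    | one => exact ⟨[], by simp, by simp⟩
    | mul x y _ _ hx hy =>
      obtain ⟨ω, hω, rfl⟩ := hx
      obtain ⟨ω', hω', rfl⟩ := hy
      refine ⟨ω ++ ω', fun i hi => ?_, cs.wordProd_append _ _⟩
      exact (List.mem_append.1 hi).elim (hω i) (hω' i)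
    | inv x _ hx =>
      obtain ⟨ω, hω, rfl⟩ := hx
      exact ⟨ω.reverse, fun i hi => hω i (List.mem_reverse.1 hi), cs.wordProd_reverse _⟩
  · rintro ⟨ω, hω, rfl⟩
    induction ω with
    | nil => simp
    | cons i ω ih =>
      rw [cs.wordProd_cons]
      exact mul_mem (simple_mem_parabolic (hω i (by simp))) (ih fun j hj => hω j (by simp [hj]))

lemma mem_parabolic_of_inversionParity_ne_zero {b t : W} (hb : b ∈ parabolic cs I)
    (h : inversionParity cs b t ≠ 0) : t ∈ parabolic cs I := by
  classical
  induction hb using Subgroup.closure_induction generalizing t with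
  | mem x hx =>
    obtain ⟨i, hi, rfl⟩ := hx
    rw [inversionParity_simple] at h
    by_cases ht : t = cs.simple i
    · exact ht ▸ simple_mem_parabolic hi
    · simp [ht] at h
  | one => simp at h
  | mul x y _ hy hx' hy' =>
    rw [inversionParity_mul] at h
    by_cases h0 : inversionParity cs y t = 0
    · rw [h0, zero_add] at h
      have := mul_mem (mul_mem (inv_mem hy) (hx' h)) hy
      change t ∈ Subgroup.closure _
      simpa [mul_assoc] using this
    · exact hy' h0
  | inv x hx hx' =>
    rw [← inversionParity_inv, inv_inv] at h
    have := mul_mem (mul_mem hx (hx' h)) (inv_mem hx)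
    change t ∈ Subgroup.closure _
    simpa [mul_assoc] using this

/-- Deletion argument, on a shortest word for `b` with letters in `I`: if its last letter is not a
descent of `b`, it is an inversion of the preceding prefix, and erasing a letter there gives a
shorter such word. -/
lemma eq_one_of_mem_parabolic_of_inversionParity_eq_zero {b : W} (hb : b ∈ parabolic cs I)
    (h : ∀ i ∈ I, inversionParity cs b (cs.simple i) = 0) : b = 1 := by
  classical
  have hex : ∃ n, ∃ ω : List B, ω.length = n ∧ (∀ i ∈ ω, i ∈ I) ∧ cs.wordProd ω = b := by
    obtain ⟨ω, h1, h2⟩ := mem_parabolic_iff_exists_wordProd.1 hb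
    exact ⟨_, ω, rfl, h1, h2⟩
  obtain ⟨ω, hlen, hωI, hω⟩ := Nat.find_spec hex
  have hmin : ∀ ω' : List B, (∀ i ∈ ω', i ∈ I) → cs.wordProd ω' = b → ω.length ≤ ω'.length :=
    fun ω' h1 h2 => hlen ▸ Nat.find_min' hex ⟨ω', rfl, h1, h2⟩
  rcases List.eq_nil_or_concat ω with rfl | ⟨τ, i, rfl⟩
  · simpa using hω.symm
  rw [cs.wordProd_concat] at hω
  have hi : i ∈ I := hωI i (by simp)
  have hτ : inversionParity cs (cs.wordProd τ) (cs.simple i) ≠ 0 := by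
    intro h0
    have h1 := inversionParity_mul_simple_self cs (cs.wordProd τ) i
    rw [hω, h i hi, h0] at h1
    exact absurd h1 (by decide)
  obtain ⟨k, hk, hki⟩ := List.mem_iff_getElem.1 (mem_rightInvSeq_of_inversionParity_ne_zero cs hτ)
  have hd := cs.wordProd_mul_getD_rightInvSeq τ k
  rw [List.getD_eq_getElem _ _ hk, hki, hω] at hd
  have := hmin (τ.eraseIdx k) (fun j hj => hωI j (by
    simp [List.mem_of_mem_eraseIdx hj])) hd.symm
  have h2 := List.length_eraseIdx_le τ k
  simp at this
  omega

lemma exists_inversionParity_eq_one {r : W} (hr : r ∈ parabolic cs I) (h1 : r ≠ 1) :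
    ∃ i ∈ I, inversionParity cs r (cs.simple i) ≠ 0 := by
  by_contra! h
  exact h1 (eq_one_of_mem_parabolic_of_inversionParity_eq_zero hr h)

/-- Every coset of a standard parabolic subgroup contains an element without inversions in that
subgroup. -/
lemma exists_mul_eq_of_parabolic (cs : CoxeterSystem M W) (I : Finset B) (w : W) :
    ∃ u b, b ∈ parabolic cs I ∧ u * b = w ∧
      ∀ t ∈ parabolic cs I, inversionParity cs u t = 0 := by
  classical
  have hex : ∃ n, ∃ b ∈ parabolic cs I, cs.length (w * b) = n := ⟨_, 1, one_mem _, rfl⟩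
  obtain ⟨b, hb, hlen⟩ := Nat.find_spec hex
  refine ⟨w * b, b⁻¹, inv_mem hb, by simp, fun t ht => ?_⟩
  by_contra hn
  have h1 := length_mul_lt_of_inversionParity_ne_zero cs hn
  rw [hlen] at h1
  exact Nat.find_min hex h1 ⟨b * t, mul_mem hb ht, by rw [mul_assoc]⟩

/-- Passes from simple reflections to all of `W_I`: in `u = u'b` with `u'` free of inversions in
`W_I`, the factor `b` has no descent in `I`, so `b = 1`. -/
lemma inversionParity_eq_zero_of_mem_cosetReps {u t : W} (hu : u ∈ cosetReps cs I)
    (ht : t ∈ parabolic cs I) : inversionParity cs u t = 0 := by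
  rw [mem_cosetReps_iff] at hu
  obtain ⟨u', b, hb, rfl, hu'⟩ := exists_mul_eq_of_parabolic cs I u
  have hb1 : b = 1 := by
    refine eq_one_of_mem_parabolic_of_inversionParity_eq_zero hb fun i hi => ?_
    have h := hu i hi
    rwa [inversionParity_mul, hu' _ (mul_mem (mul_mem hb (simple_mem_parabolic hi)) (inv_mem hb)),
      add_zero] at h
  rw [hb1, mul_one]
  exact hu' t ht

/-- Every element is the product of a minimal coset representative and an element of the
parabolic subgroup. -/
lemma exists_mem_cosetReps_mul_eq (cs : CoxeterSystem M W) (I : Finset B) (w : W) :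
    ∃ u b, u ∈ cosetReps cs I ∧ b ∈ parabolic cs I ∧ u * b = w := by
  obtain ⟨u, b, hb, h, hu⟩ := exists_mul_eq_of_parabolic cs I w
  exact ⟨u, b, (mem_cosetReps_iff cs).2 fun i hi => hu _ (simple_mem_parabolic hi), hb, h⟩

lemma eq_of_mem_cosetReps_of_mul_eq {u u' b b' : W} (hu : u ∈ cosetReps cs I)
    (hu' : u' ∈ cosetReps cs I) (hb : b ∈ parabolic cs I) (hb' : b' ∈ parabolic cs I)
    (h : u * b = u' * b') : u = u' := by
  have hc : u = u' * (b' * b⁻¹) := by rw [← mul_assoc, ← h]; simp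
  have hm : b' * b⁻¹ ∈ parabolic cs I := mul_mem hb' (inv_mem hb)
  suffices b' * b⁻¹ = 1 by rw [hc, this, mul_one]
  refine eq_one_of_mem_parabolic_of_inversionParity_eq_zero hm fun i hi => ?_
  have h0 := (mem_cosetReps_iff cs).1 hu i hi
  rwa [hc, inversionParity_mul, inversionParity_eq_zero_of_mem_cosetReps hu'
    (mul_mem (mul_mem hm (simple_mem_parabolic hi)) (inv_mem hm)), add_zero] at h0

lemma inversionParity_mul_of_mem_parabolic {u b t : W} (hu : u ∈ cosetReps cs I)
    (hb : b ∈ parabolic cs I) (ht : t ∈ parabolic cs I) :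
    inversionParity cs (u * b) t = inversionParity cs b t := by
  rw [inversionParity_mul, inversionParity_eq_zero_of_mem_cosetReps hu
    (mul_mem (mul_mem hb ht) (inv_mem hb)), add_zero]

end Parabolic

/-! ### Solomon's product formula and the descent algebra. -/

section Product

variable {B W : Type*} [Group W] {M : CoxeterMatrix B} (cs : CoxeterSystem M W)

open scoped Classical in
/-- The simple reflections in `J` which `d` conjugates to simple reflections in `I`. -/
noncomputable def conjPart (I J : Finset B) (d : W) : Finset B :=
  {j ∈ J | ∃ i ∈ I, d * cs.simple j * d⁻¹ = cs.simple i}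

variable {cs} {I J K : Finset B}

lemma mem_conjPart {d : W} {j : B} :
    j ∈ conjPart cs I J d ↔ j ∈ J ∧ ∃ i ∈ I, d * cs.simple j * d⁻¹ = cs.simple i := by
  simp [conjPart]

lemma conjPart_subset (d : W) : conjPart cs I J d ⊆ J := fun _ hj => (mem_conjPart.1 hj).1

/-- Let `s_i` be a descent of `r = d s_j d⁻¹`, and evaluate the parity of `rd = d s_j` at `d⁻¹ s_i
d` in both factorizations. As `d` contributes nothing either way, `d⁻¹ s_i d` is an inversion of
`s_j`, hence equals `s_j`. -/
lemma exists_simple_eq_conj_of_mem_parabolic {d : W} {j : B} (hd : d⁻¹ ∈ cosetReps cs I)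
    (hr : d * cs.simple j * d⁻¹ ∈ parabolic cs I) :
    ∃ i ∈ I, d * cs.simple j * d⁻¹ = cs.simple i := by
  classical
  have h1 : d * cs.simple j * d⁻¹ ≠ 1 := by
    intro h
    have h2 : cs.simple j = 1 := by simpa using h
    have h3 := inversionParity_simple_self cs j
    rw [h2, inversionParity_one] at h3
    exact zero_ne_one h3
  obtain ⟨i, hi, hne⟩ := exists_inversionParity_eq_one hr h1
  refine ⟨i, hi, ?_⟩
  set r := d * cs.simple j * d⁻¹ with hrdef
  have e1 : inversionParity cs (r * d) (d⁻¹ * cs.simple i * d) ≠ 0 := by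
    rw [inversionParity_mul, ← inversionParity_inv,
      show d * (d⁻¹ * cs.simple i * d) * d⁻¹ = cs.simple i by simp [mul_assoc],
      inversionParity_eq_zero_of_mem_cosetReps hd (simple_mem_parabolic hi), zero_add]
    exact hne
  rw [show r * d = d * cs.simple j by simp [hrdef], inversionParity_mul,
    ← inversionParity_inv cs d,
    show d * (cs.simple j * (d⁻¹ * cs.simple i * d) * (cs.simple j)⁻¹) * d⁻¹ =
      r * cs.simple i * r⁻¹ by simp [hrdef, mul_assoc],
    inversionParity_eq_zero_of_mem_cosetReps hd
      (mul_mem (mul_mem hr (simple_mem_parabolic hi)) (inv_mem hr)), add_zero,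
    inversionParity_simple] at e1
  have e2 : d⁻¹ * cs.simple i * d = cs.simple j := by
    by_contra h
    simp [h] at e1
  rw [hrdef, ← e2]
  simp [mul_assoc]

lemma mem_cosetReps_of_parabolic_mul {b d : W} (hd : d⁻¹ ∈ cosetReps cs I)
    (hb : b ∈ parabolic cs I) (h : b * d ∈ cosetReps cs J) : d ∈ cosetReps cs J := by
  rw [mem_cosetReps_iff] at h ⊢
  intro j hj
  by_contra hn
  have h0 : inversionParity cs b (d * cs.simple j * d⁻¹) = 0 := by
    by_contra hb0
    refine hn ?_
    rw [← inversionParity_inv]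
    exact inversionParity_eq_zero_of_mem_cosetReps hd
      (mem_parabolic_of_inversionParity_ne_zero hb hb0)
  have := h j hj
  rw [inversionParity_mul, h0, add_zero] at this
  exact hn this

/-- A descent `s_j` of `bd` with `j ∈ J` is an inversion `d s_j d⁻¹` of `b`. It lies in `W_I`, so it
is simple in `I`, and the factor `u` does not affect it. -/
lemma mul_mem_cosetReps_iff {u b d : W} (hu : u ∈ cosetReps cs I) (hb : b ∈ parabolic cs I)
    (hd : d⁻¹ ∈ cosetReps cs I) (hdJ : d ∈ cosetReps cs J) :
    b * d ∈ cosetReps cs J ↔ u * b * d ∈ cosetReps cs (conjPart cs I J d) := by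
  simp only [mem_cosetReps_iff] at hdJ ⊢
  constructor
  · intro h j hj
    obtain ⟨hjJ, i, hi, hij⟩ := mem_conjPart.1 hj
    have := h j hjJ
    rw [inversionParity_mul, hij] at this ⊢
    rwa [inversionParity_mul_of_mem_parabolic hu hb (simple_mem_parabolic hi)]
  · intro h j hj
    rw [inversionParity_mul, hdJ j hj, zero_add]
    by_contra hn
    obtain ⟨i, hi, hij⟩ := exists_simple_eq_conj_of_mem_parabolic hd
      (mem_parabolic_of_inversionParity_ne_zero hb hn)
    have := h j (mem_conjPart.2 ⟨hj, i, hi, hij⟩)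
    rw [inversionParity_mul, hdJ j hj, zero_add, hij,
      inversionParity_mul_of_mem_parabolic hu hb (simple_mem_parabolic hi), ← hij] at this
    exact hn this

lemma exists_parabolic_mul_inv_mem_cosetReps (cs : CoxeterSystem M W) (I : Finset B) (v : W) :
    ∃ d, d⁻¹ ∈ cosetReps cs I ∧ v * d⁻¹ ∈ parabolic cs I := by
  obtain ⟨u, b, hu, hb, h⟩ := exists_mem_cosetReps_mul_eq cs I v⁻¹
  refine ⟨u⁻¹, by simpa using hu, ?_⟩
  have : v = b⁻¹ * u⁻¹ := by rw [← mul_inv_rev, h, inv_inv]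
  rw [this]
  simpa using hb

lemma eq_of_inv_mem_cosetReps {v d d' : W} (hd : d⁻¹ ∈ cosetReps cs I)
    (hd' : d'⁻¹ ∈ cosetReps cs I) (h : v * d⁻¹ ∈ parabolic cs I)
    (h' : v * d'⁻¹ ∈ parabolic cs I) : d = d' := by
  have := eq_of_mem_cosetReps_of_mul_eq hd hd' (inv_mem h) (inv_mem h') (by simp)
  simpa using this

variable [Fintype W]

open scoped Classical in
/-- Solomon's formula for the product of two basic elements of the descent algebra. -/
lemma xElt_mul_xElt (cs : CoxeterSystem M W) (I J : Finset B) :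
    xElt cs I * xElt cs J =
      ∑ d : W with d⁻¹ ∈ cosetReps cs I ∧ d ∈ cosetReps cs J,
        xElt cs (conjPart cs I J d) := by
  choose m hm hmv using exists_parabolic_mul_inv_mem_cosetReps cs I
  simp only [xElt, Finset.sum_mul_sum, MonoidAlgebra.single_mul_single, mul_one]
  rw [Finset.sum_sigma', Finset.sum_sigma']
  -- The bijection is `(u, v) ↦ (d, uv)`, with `d` the minimal representative of `W_I v`.
  refine Finset.sum_bij (fun p _ => ⟨m p.2, p.1 * p.2⟩) ?_ ?_ ?_ ?_
  · rintro ⟨u, v⟩ hp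
    simp only [Finset.mem_sigma, Finset.mem_filter, Finset.mem_univ, true_and] at hp ⊢
    have hv : v * (m v)⁻¹ * m v ∈ cosetReps cs J := by simpa using hp.2
    have hdJ := mem_cosetReps_of_parabolic_mul (hm v) (hmv v) hv
    refine ⟨⟨hm v, hdJ⟩, ?_⟩
    have := (mul_mem_cosetReps_iff hp.1 (hmv v) (hm v) hdJ).1 hv
    simpa [mul_assoc] using this
  · rintro ⟨u, v⟩ hp ⟨u', v'⟩ hp' h
    simp only [Finset.mem_sigma, Finset.mem_filter, Finset.mem_univ, true_and] at hp hp'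
    simp only [Sigma.mk.injEq, heq_eq_eq] at h
    have hu : u = u' := by
      refine eq_of_mem_cosetReps_of_mul_eq hp.1 hp'.1 (hmv v) (hmv v') ?_
      rw [← mul_assoc, ← mul_assoc, h.1, h.2]
    subst hu
    simpa using h.2
  · rintro ⟨d, w⟩ hp
    simp only [Finset.mem_sigma, Finset.mem_filter, Finset.mem_univ, true_and] at hp
    obtain ⟨⟨hd, hdJ⟩, hw⟩ := hp
    obtain ⟨u, b, hu, hb, h⟩ := exists_mem_cosetReps_mul_eq cs I (w * d⁻¹)
    have hw' : u * b * d = w := by simp [h]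
    have hmd : m (b * d) = d :=
      eq_of_inv_mem_cosetReps (v := b * d) (hm _) hd (hmv _) (by simpa using hb)
    refine ⟨⟨u, b * d⟩, ?_, ?_⟩
    · simp only [Finset.mem_sigma, Finset.mem_filter, Finset.mem_univ, true_and]
      exact ⟨hu, (mul_mem_cosetReps_iff hu hb hd hdJ).2 (hw' ▸ hw)⟩
    · simp only [hmd, ← mul_assoc, hw']
  · rintro ⟨u, v⟩ _
    rfl

lemma xElt_univ [Fintype B] (cs : CoxeterSystem M W) : xElt cs Finset.univ = 1 := by
  classical
  have : ∀ w : W, w ∈ cosetReps cs Finset.univ ↔ w = 1 := by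
    intro w
    refine ⟨fun h => ?_, fun h => ?_⟩
    · by_contra hne
      obtain ⟨i, hi⟩ := cs.exists_rightDescent_of_ne_one hne
      exact absurd (h i (Finset.mem_univ i)) (not_lt.2 (le_of_lt hi))
    · subst h
      exact (mem_cosetReps_iff cs).2 fun i _ => inversionParity_one cs _
  simp only [xElt, this]
  rw [Finset.filter_eq' Finset.univ (1 : W), if_pos (Finset.mem_univ _), Finset.sum_singleton]
  rfl

/-- The space spanned by the elements `xElt cs I` as a subalgebra of the group algebra. -/
noncomputable def descentAlgebra [Fintype B] (cs : CoxeterSystem M W) :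
    Subalgebra ℚ (MonoidAlgebra ℚ W) :=
  (descentSpace cs).toSubalgebra
    (by rw [← xElt_univ cs]; exact Submodule.subset_span ⟨_, rfl⟩) (by
      intro x y hx hy
      have h : descentSpace cs * descentSpace cs ≤ descentSpace cs := by
        rw [descentSpace, Submodule.span_mul_span, Submodule.span_le]
        rintro _ ⟨_, ⟨I, rfl⟩, _, ⟨J, rfl⟩, rfl⟩
        simp only [xElt_mul_xElt]
        exact Submodule.sum_mem _ fun d _ => Submodule.subset_span ⟨_, rfl⟩
      exact h (Submodule.mul_mem_mul hx hy))

end Product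

/-! ### Annihilating polynomials from triangularity. -/

section Annihilator

/-- If left multiplication by `a` is triangular with respect to a spanning family, with respect to
a ranking through which the diagonal entries factor, then `a` is annihilated by the product of the
corresponding linear factors, one for each rank. -/
lemma aeval_prod_X_sub_C_eq_zero {F A ι α : Type*} [Field F] [Ring A] [Algebra F A] [Fintype ι]
    [LinearOrder α] (x : ι → A) (a : A) (r : ι → α) (μ : α → F)
    (h : ∀ j, a * x j - μ (r j) • x j ∈ Submodule.span F (x '' {k | r j < r k}))
    (h1 : (1 : A) ∈ Submodule.span F (Set.range x)) :
    aeval a (∏ v ∈ Finset.univ.image r, (X - C (μ v))) = 0 := by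
  classical
  -- Induction from the top rank down: the factor at rank `r j` moves `x j` into strictly higher
  -- ranks, which the remaining factors kill.
  have key : ∀ j, aeval a (∏ v ∈ Finset.univ.image r with r j ≤ v, (X - C (μ v))) * x j = 0 := by
    have hirr : Std.Irrefl (fun k j : ι => r j < r k) := ⟨fun _ => lt_irrefl _⟩
    have htr : IsTrans ι (fun k j : ι => r j < r k) := ⟨fun _ _ _ h1 h2 => h2.trans h1⟩
    have hwf : WellFounded (fun k j : ι => r j < r k) :=
      Finite.wellFounded_of_trans_of_irrefl _
    intro j
    induction j using hwf.induction with
    | _ j ih =>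
      have hset : {v ∈ Finset.univ.image r | r j ≤ v} =
          insert (r j) {v ∈ Finset.univ.image r | r j < v} := by
        ext v
        simp only [Finset.mem_filter, Finset.mem_insert, le_iff_eq_or_lt]
        constructor
        · rintro ⟨hv, rfl | hlt⟩
          · exact Or.inl rfl
          · exact Or.inr ⟨hv, hlt⟩
        · rintro (rfl | ⟨hv, hlt⟩)
          · exact ⟨Finset.mem_image_of_mem r (Finset.mem_univ j), Or.inl rfl⟩
          · exact ⟨hv, Or.inr hlt⟩
      rw [hset, Finset.prod_insert (by simp), mul_comm, map_mul, mul_assoc]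
      have hlin : aeval a (X - C (μ (r j))) * x j = a * x j - μ (r j) • x j := by
        rw [map_sub, aeval_X, aeval_C, sub_mul, Algebra.smul_def]
      rw [hlin]
      have hj := h j
      generalize a * x j - μ (r j) • x j = z at hj ⊢
      induction hj using Submodule.span_induction with
      | mem y hy =>
        obtain ⟨k, hk, rfl⟩ := hy
        have hsub : {v ∈ Finset.univ.image r | r k ≤ v} ⊆ {v ∈ Finset.univ.image r | r j < v} :=
          fun v hv => Finset.mem_filter.2 ⟨(Finset.mem_filter.1 hv).1,
            lt_of_lt_of_le hk (Finset.mem_filter.1 hv).2⟩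
        rw [← Finset.prod_sdiff hsub, map_mul, mul_assoc, ih k hk, mul_zero]
      | zero => rw [mul_zero]
      | add y z _ _ hy hz => rw [mul_add, hy, hz, add_zero]
      | smul c y _ hy => rw [mul_smul_comm, hy, smul_zero]
  rw [← mul_one (aeval a _)]
  generalize (1 : A) = z at h1 ⊢
  induction h1 using Submodule.span_induction with
  | mem y hy =>
    obtain ⟨k, rfl⟩ := hy
    rw [← Finset.prod_sdiff (Finset.filter_subset (fun v => r k ≤ v) (Finset.univ.image r)),
      map_mul, mul_assoc, key k, mul_zero]
  | zero => rw [mul_zero]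
  | add y z _ _ hy hz => rw [mul_add, hy, hz, add_zero]
  | smul c y _ hy => rw [mul_smul_comm, hy, smul_zero]

/-- `X` divides `p` at most once, so `p ∣ X * s` with `s` coprime to `X ^ n`; multiply the Bézout
identity by `X`. -/
lemma exists_eq_pow_mul_aeval_of_squarefree {F A : Type*} [Field F] [Ring A] [Algebra F A] {a : A}
    {p : F[X]} (hp : Squarefree p) (h0 : aeval a p = 0) (n : ℕ) :
    ∃ q : F[X], a = a ^ n * aeval a q := by
  obtain ⟨s, hs, hps⟩ : ∃ s : F[X], ¬ X ∣ s ∧ p ∣ X * s := by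
    by_cases hX : (X : F[X]) ∣ p
    · obtain ⟨s, rfl⟩ := hX
      refine ⟨s, fun hs => ?_, dvd_rfl⟩
      exact not_isUnit_X (hp X (mul_dvd_mul_left X hs))
    · exact ⟨p, hX, dvd_mul_left _ _⟩
  obtain ⟨u, v, huv⟩ := ((irreducible_X.coprime_iff_not_dvd.2 hs).pow_left : IsCoprime (X ^ n) s)
  obtain ⟨t, ht⟩ := hps
  refine ⟨X * u, ?_⟩
  have e : (X : F[X]) = X ^ n * (X * u) + v * (p * t) := by
    rw [← ht]
    linear_combination (-X) * huv
  have := congrArg (aeval a) e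
  simpa [h0] using this

lemma squarefree_prod_X_sub_C {F : Type*} [Field F] (s : Finset F) :
    Squarefree (∏ v ∈ s, (X - C v)) :=
  (separable_prod_X_sub_C_iff' (s := s) (f := fun v => v)).2 (fun _ _ _ _ h => h) |>.squarefree

end Annihilator

/-! ### Eigenvalues of left multiplication. -/

section Triangular

variable {B W : Type*} [Group W] [Fintype W] {M : CoxeterMatrix B} (cs : CoxeterSystem M W)

open scoped Classical in
/-- The elements which conjugate the simple reflections in `J` to simple reflections in `I` and
whose inverses are minimal coset representatives for `I`. -/
noncomputable def conjugators (I J : Finset B) : Finset W :=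
  {d | d⁻¹ ∈ cosetReps cs I ∧ ∀ j ∈ J, ∃ i ∈ I, d * cs.simple j * d⁻¹ = cs.simple i}

variable {cs} {I J K : Finset B}

lemma mem_conjugators {d : W} : d ∈ conjugators cs I J ↔
    d⁻¹ ∈ cosetReps cs I ∧ ∀ j ∈ J, ∃ i ∈ I, d * cs.simple j * d⁻¹ = cs.simple i := by
  simp [conjugators]

lemma mem_conjugators_iff_conjPart_eq {d : W} : d ∈ conjugators cs I J ↔
    (d⁻¹ ∈ cosetReps cs I ∧ d ∈ cosetReps cs J) ∧ conjPart cs I J d = J := by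
  rw [mem_conjugators]
  constructor
  · rintro ⟨hd, h⟩
    refine ⟨⟨hd, (mem_cosetReps_iff cs).2 fun j hj => ?_⟩, ?_⟩
    · obtain ⟨i, hi, hij⟩ := h j hj
      rw [← inversionParity_inv, hij]
      exact (mem_cosetReps_iff cs).1 hd i hi
    · exact (conjPart_subset d).antisymm fun j hj => mem_conjPart.2 ⟨hj, h j hj⟩
  · rintro ⟨⟨hd, -⟩, h⟩
    refine ⟨hd, fun j hj => ?_⟩
    rw [← h] at hj
    exact (mem_conjPart.1 hj).2

lemma conjugators_anti (h : K ⊆ J) : conjugators cs I J ⊆ conjugators cs I K := fun _ hd =>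
  mem_conjugators.2 ⟨(mem_conjugators.1 hd).1, fun j hj => (mem_conjugators.1 hd).2 j (h hj)⟩

/-- The inclusion of conjugator sets is strict because `d` itself lies only in the larger one. -/
lemma card_conjugators_lt {d : W} (hd : d⁻¹ ∈ cosetReps cs I) (hne : conjPart cs I J d ≠ J) :
    (conjugators cs I J).card < (conjugators cs I (conjPart cs I J d)).card := by
  refine Finset.card_lt_card ⟨conjugators_anti (conjPart_subset d), fun h => hne ?_⟩
  refine (mem_conjugators_iff_conjPart_eq.1 (h (mem_conjugators.2 ⟨hd, fun j hj => ?_⟩))).2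
  exact (mem_conjPart.1 hj).2

lemma xElt_mul_xElt_sub_mem (cs : CoxeterSystem M W) (I J : Finset B) :
    xElt cs I * xElt cs J - ((conjugators cs I J).card : ℚ) • xElt cs J ∈
      Submodule.span ℚ (xElt cs '' {K | K ⊂ J ∧
        (conjugators cs I J).card < (conjugators cs I K).card}) := by
  classical
  rw [xElt_mul_xElt, ← Finset.sum_filter_add_sum_filter_not _ (fun d => conjPart cs I J d = J)]
  have e : ∑ d ∈ ({d : W | d⁻¹ ∈ cosetReps cs I ∧ d ∈ cosetReps cs J} : Finset W) with
      conjPart cs I J d = J, xElt cs (conjPart cs I J d) =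
      ((conjugators cs I J).card : ℚ) • xElt cs J := by
    rw [Finset.sum_congr rfl (g := fun _ => xElt cs J)
      (fun d hd => by rw [(Finset.mem_filter.1 hd).2]), Finset.sum_const, Nat.cast_smul_eq_nsmul]
    congr 2
    ext d
    simp [mem_conjugators_iff_conjPart_eq]
  rw [e, add_sub_cancel_left]
  refine Submodule.sum_mem _ fun d hd => Submodule.subset_span ⟨_, ?_, rfl⟩
  simp only [Finset.mem_filter, Finset.mem_univ, true_and] at hd
  exact ⟨(conjPart_subset d).ssubset_of_ne hd.2, card_conjugators_lt hd.1.1 hd.2⟩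

variable [Fintype B]

/-- The eigenvalues of left multiplication by a linear combination of the elements `xElt cs I`. -/
noncomputable def eigenvalue (cs : CoxeterSystem M W) (c : Finset B → ℚ) (J : Finset B) : ℚ :=
  ∑ I, c I * (conjugators cs I J).card

lemma sum_smul_xElt_mul_sub_mem (cs : CoxeterSystem M W) (c : Finset B → ℚ) (J : Finset B) :
    (∑ I, c I • xElt cs I) * xElt cs J - eigenvalue cs c J • xElt cs J ∈
      Submodule.span ℚ (xElt cs '' {K | K ⊂ J ∧ ∃ I, c I ≠ 0 ∧
        (conjugators cs I J).card < (conjugators cs I K).card}) := by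
  rw [Finset.sum_mul, eigenvalue, Finset.sum_smul, ← Finset.sum_sub_distrib]
  refine Submodule.sum_mem _ fun I _ => ?_
  rw [smul_mul_assoc, mul_smul, ← smul_sub]
  by_cases hc : c I = 0
  · simp [hc]
  · refine Submodule.smul_mem _ _ (Submodule.span_mono (Set.image_mono ?_)
      (xElt_mul_xElt_sub_mem cs I J))
    exact fun K hK => ⟨hK.1, I, hc, hK.2⟩

lemma eigenvalue_lt {c : Finset B → ℚ} (hc : ∀ I, 0 ≤ c I) (hK : K ⊂ J)
    (h : ∃ I, c I ≠ 0 ∧ (conjugators cs I J).card < (conjugators cs I K).card) :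
    eigenvalue cs c J < eigenvalue cs c K := by
  obtain ⟨I, hI, hlt⟩ := h
  refine Finset.sum_lt_sum (fun L _ => ?_) ⟨I, Finset.mem_univ I, ?_⟩
  · exact mul_le_mul_of_nonneg_left
      (Nat.cast_le.2 (Finset.card_le_card (conjugators_anti hK.subset))) (hc L)
  · exact mul_lt_mul_of_pos_left (Nat.cast_lt.2 hlt) (lt_of_le_of_ne (hc I) hI.symm)

lemma one_mem_span_xElt (cs : CoxeterSystem M W) :
    (1 : MonoidAlgebra ℚ W) ∈ Submodule.span ℚ (Set.range (xElt cs)) := by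
  rw [← xElt_univ cs]
  exact Submodule.subset_span ⟨_, rfl⟩

lemma exists_splits_aeval_eq_zero {a : MonoidAlgebra ℚ W} (ha : a ∈ descentSpace cs) :
    ∃ p : ℚ[X], p ≠ 0 ∧ p.Splits ∧ aeval a p = 0 := by
  classical
  obtain ⟨c, rfl⟩ := (Submodule.mem_span_range_iff_exists_fun ℚ).1 ha
  -- Coefficients of arbitrary sign do not order the eigenvalues, so the rank is a linear extension
  -- of reverse inclusion; roots may repeat.
  let r : Finset B → LinearExtension (Finset B)ᵒᵈ := fun J => toLinearExtension (OrderDual.toDual J)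
  let μ : LinearExtension (Finset B)ᵒᵈ → ℚ := fun v => eigenvalue cs c (OrderDual.ofDual v)
  refine ⟨∏ v ∈ Finset.univ.image r, (X - C (μ v)),
    Finset.prod_ne_zero_iff.2 fun v _ => X_sub_C_ne_zero _,
    Splits.prod fun v _ => Splits.X_sub_C _,
    aeval_prod_X_sub_C_eq_zero (xElt cs) _ r μ (fun J => ?_) (one_mem_span_xElt cs)⟩
  refine Submodule.span_mono (Set.image_mono fun K hK => ?_) (sum_smul_xElt_mul_sub_mem cs c J)
  have hle : r J ≤ r K := toLinearExtension.monotone (OrderDual.toDual_le_toDual.2 hK.1.subset)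
  exact lt_of_le_of_ne hle fun h => hK.1.ne (show J = K from h).symm

lemma exists_squarefree_aeval_eq_zero {a : MonoidAlgebra ℚ W} (ha : a ∈ descentCone cs) :
    ∃ p : ℚ[X], Squarefree p ∧ aeval a p = 0 := by
  obtain ⟨c, hc, rfl⟩ := ha
  -- The rank is now the eigenvalue itself, so the roots are distinct.
  refine ⟨_, squarefree_prod_X_sub_C _, aeval_prod_X_sub_C_eq_zero (xElt cs) _ (eigenvalue cs c)
    (fun v => v) (fun J => ?_) (one_mem_span_xElt cs)⟩
  exact Submodule.span_mono (Set.image_mono fun K hK => eigenvalue_lt hc hK.1 hK.2)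
    (sum_smul_xElt_mul_sub_mem cs c J)

end Triangular

end SolomonDescent

theorem mainTheorem5 {B W : Type*} [Fintype B] [Group W] [Fintype W] {M : CoxeterMatrix B}
    (cs : CoxeterSystem M W) :
    ∃ A : Subalgebra ℚ (MonoidAlgebra ℚ W),
      Subalgebra.toSubmodule A = SolomonDescent.descentSpace cs ∧
      (∀ a : A, (minpoly ℚ a).Splits) ∧
      ∀ a : A, (a : MonoidAlgebra ℚ W) ∈ SolomonDescent.descentCone cs →
        Squarefree (minpoly ℚ a) ∧
        (∀ n : ℕ, 1 ≤ n →
          Set.range (fun x : A => a ^ n * x) = Set.range (fun x : A => a * x) ∧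
          Set.range (fun x : A => x * a ^ n) = Set.range (fun x : A => x * a)) ∧
        ∀ (V : Type*) [AddCommGroup V] [Module ℚ V] [Module A V] [IsScalarTower ℚ A V],
          (Algebra.lsmul ℚ ℚ V a : Module.End ℚ V).IsSemisimple := by
  refine ⟨SolomonDescent.descentAlgebra cs, Submodule.toSubalgebra_toSubmodule _ _ _,
    fun a => ?_, fun a ha => ?_⟩
  · obtain ⟨p, hp0, hp, h⟩ := SolomonDescent.exists_splits_aeval_eq_zero (cs := cs) a.2
    rw [← Polynomial.aeval_subalgebra_coe] at h
    exact hp.of_dvd hp0 (minpoly.dvd ℚ a (Subtype.ext h))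
  · obtain ⟨p, hp, h⟩ := SolomonDescent.exists_squarefree_aeval_eq_zero ha
    rw [← Polynomial.aeval_subalgebra_coe] at h
    have hpa : Polynomial.aeval a p = 0 := Subtype.ext h
    refine ⟨hp.squarefree_of_dvd (minpoly.dvd ℚ a hpa), fun n hn => ?_, ?_⟩
    · obtain ⟨q, hq⟩ := SolomonDescent.exists_eq_pow_mul_aeval_of_squarefree hp hpa n
      obtain ⟨m, rfl⟩ := Nat.exists_eq_add_of_le' hn
      have hcomm : Polynomial.aeval a q * a ^ (m + 1) = a ^ (m + 1) * Polynomial.aeval a q := by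
        rw [← Polynomial.aeval_X_pow (R := ℚ) a, ← map_mul, ← map_mul, mul_comm]
      constructor <;> apply Set.Subset.antisymm <;> rintro _ ⟨x, rfl⟩
      · exact ⟨a ^ m * x, by simp only [pow_succ', mul_assoc]⟩
      · exact ⟨Polynomial.aeval a q * x, by simp only [← mul_assoc, ← hq]⟩
      · exact ⟨x * a ^ m, by simp only [pow_succ, mul_assoc]⟩
      · exact ⟨x * Polynomial.aeval a q, by simp only [mul_assoc, hcomm, ← hq]⟩
    · intro V _ _ _ _
      refine Module.End.isSemisimple_of_squarefree_aeval_eq_zero hp ?_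
      rw [Polynomial.aeval_algHom_apply, hpa, map_zero]
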